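/- Conventions. A unary semigroup $\mathcal S=\langle S,\cdot,{}^*\rangle$ is a semigroup $\langle S,\cdot\rangle$ (its semigroup reduct) equipped with an arbitrary additional unary operation $x\mapsto x^*$; it is an involutory semigroup if it satisfies $(xy)^*=y^*x^*$ and $(x^*)^*=x$. A variety of [unary] semigroups is a class of [unary] semigroups closed under homomorphic images, [unary] subsemigroups and direct products; $\operatorname{var}\mathcal S$ denotes the smallest variety of unary semigroups containing $\mathcal S$. A variety is finitely based if it is the class of all [unary] semigroups satisfying some finite set of identities, and locally finite if each of its finitely generated members is finite. A finite [unary] semigroup is inherently non-finitely based (INFB) if it is not contained in any locally finite finitely based variety of [unary] semigroups. The 3-element twisted semilattice $\mathcal{TSL}=\langle\{e,f,0\},\cdot,{}^*\rangle$ is the involutory semigroup in which $e^2=e$, $f^2=f$, all other products equal $0$, and $e^*=f$, $f^*=e$, $0^*=0$. Theorem. Let $\mathcal S=\langle S,\cdot,{}^*\rangle$ be a finite involutory semigroup such that $\mathcal{TSL}\in\operatorname{var}\mathcal S$. If the semigroup reduct $\langle S,\cdot\rangle$ is INFB (as a semigroup), then $\mathcal S$ is INFB as a unary semigroup. -/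

import Mathlib

universe u

/-! ### Plain semigroups: identities, varieties, the property INFB -/

/-- A class of semigroups (in a fixed universe). -/
abbrev SemigroupClass : Type (u + 1) :=
  ∀ (A : Type u) [Semigroup A], Prop

/-- A plain semigroup identity `p.1 = p.2` between plain words over a countably infinite alphabet. -/
abbrev PlainIdentity : Type :=
  FreeSemigroup ℕ × FreeSemigroup ℕ

/-- The semigroup `A` satisfies the plain identity `p`: both sides agree under every substitution
of elements of `A` for the letters. -/
def SatisfiesPlain (A : Type u) [Semigroup A] (p : PlainIdentity) : Prop :=
  ∀ φ : ℕ → A, FreeSemigroup.lift φ p.1 = FreeSemigroup.lift φ p.2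

/-- A variety of semigroups: a class closed under homomorphic images, (isomorphic copies of)
subsemigroups, and direct products. -/
structure IsSemigroupVariety (V : SemigroupClass.{u}) : Prop where
  image : ∀ (A B : Type u) [Semigroup A] [Semigroup B] (f : A →ₙ* B),
    Function.Surjective f → V A → V B
  sub : ∀ (A B : Type u) [Semigroup A] [Semigroup B] (f : A →ₙ* B),
    Function.Injective f → V B → V A
  prod : ∀ (ι : Type u) (A : ι → Type u) [∀ i, Semigroup (A i)],
    (∀ i, V (A i)) → V (∀ i, A i)

/-- The class `V` is defined by finitely many plain identities. -/
def SemigroupFinitelyBased (V : SemigroupClass.{u}) : Prop :=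
  ∃ E : Set PlainIdentity, E.Finite ∧
    ∀ (A : Type u) [Semigroup A], V A ↔ ∀ p ∈ E, SatisfiesPlain A p

/-- The semigroup `A` is finitely generated. -/
def SemigroupFG (A : Type u) [Semigroup A] : Prop :=
  ∃ X : Set A, X.Finite ∧ Subsemigroup.closure X = ⊤

/-- Every finitely generated semigroup in `V` is finite. -/
def SemigroupLocallyFinite (V : SemigroupClass.{u}) : Prop :=
  ∀ (A : Type u) [Semigroup A], V A → SemigroupFG A → Finite A

/-- A finite semigroup is inherently non-finitely based (INFB) if it is not contained in any
locally finite finitely based variety of semigroups. -/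
def SemigroupINFB (S : Type u) [Semigroup S] [Finite S] : Prop :=
  ¬ ∃ V : SemigroupClass.{u},
    IsSemigroupVariety V ∧ SemigroupLocallyFinite V ∧ SemigroupFinitelyBased V ∧ V S

/-! ### Unary semigroups

A unary semigroup is a semigroup with an arbitrary unary operation `star` (`[Semigroup A] [Star A]`,
no laws relating the two). An involutory semigroup is `[Semigroup A] [StarMul A]`, i.e. it also
satisfies `star (x * y) = star y * star x` and `star (star x) = x`. -/

/-- A class of unary semigroups (in a fixed universe). -/
abbrev UnarySemigroupClass : Type (u + 1) :=
  ∀ (A : Type u) [Semigroup A] [Star A], Prop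

/-- Terms in the language of one binary and one unary operation, over a countably infinite
alphabet. -/
inductive UnaryTerm : Type
  | var : ℕ → UnaryTerm
  | mul : UnaryTerm → UnaryTerm → UnaryTerm
  | starred : UnaryTerm → UnaryTerm

/-- The value of a term in a unary semigroup under a substitution of elements for letters. -/
def UnaryTerm.eval {A : Type u} [Semigroup A] [Star A] (φ : ℕ → A) : UnaryTerm → A
  | .var n => φ n
  | .mul s t => s.eval φ * t.eval φ
  | .starred t => star (t.eval φ)

/-- A unary semigroup identity `p.1 = p.2`. -/
abbrev UnaryIdentity : Type :=
  UnaryTerm × UnaryTerm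

/-- The unary semigroup `A` satisfies the identity `p`. -/
def SatisfiesUnary (A : Type u) [Semigroup A] [Star A] (p : UnaryIdentity) : Prop :=
  ∀ φ : ℕ → A, p.1.eval φ = p.2.eval φ

/-- A variety of unary semigroups: a class closed under homomorphic images, (isomorphic copies of)
unary subsemigroups, and direct products (with componentwise operations). Homomorphisms preserve
both operations. -/
structure IsUnarySemigroupVariety (V : UnarySemigroupClass.{u}) : Prop where
  image : ∀ (A B : Type u) [Semigroup A] [Star A] [Semigroup B] [Star B] (f : A →ₙ* B),
    (∀ a, f (star a) = star (f a)) → Function.Surjective f → V A → V B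
  sub : ∀ (A B : Type u) [Semigroup A] [Star A] [Semigroup B] [Star B] (f : A →ₙ* B),
    (∀ a, f (star a) = star (f a)) → Function.Injective f → V B → V A
  prod : ∀ (ι : Type u) (A : ι → Type u) [∀ i, Semigroup (A i)] [∀ i, Star (A i)],
    (∀ i, V (A i)) → V (∀ i, A i)

/-- The class `V` of unary semigroups is defined by finitely many unary semigroup identities. -/
def UnarySemigroupFinitelyBased (V : UnarySemigroupClass.{u}) : Prop :=
  ∃ E : Set UnaryIdentity, E.Finite ∧
    ∀ (A : Type u) [Semigroup A] [Star A], V A ↔ ∀ p ∈ E, SatisfiesUnary A p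

/-- The unary semigroup `A` is finitely generated: for some finite `X ⊆ A`, the only subsemigroup
of `A` that contains `X` and is closed under `star` is `A` itself. -/
def UnarySemigroupFG (A : Type u) [Semigroup A] [Star A] : Prop :=
  ∃ X : Set A, X.Finite ∧
    ∀ T : Subsemigroup A, X ⊆ T → (∀ a ∈ T, star a ∈ T) → T = ⊤

/-- Every finitely generated unary semigroup in `V` is finite. -/
def UnarySemigroupLocallyFinite (V : UnarySemigroupClass.{u}) : Prop :=
  ∀ (A : Type u) [Semigroup A] [Star A], V A → UnarySemigroupFG A → Finite A

/-- A finite unary semigroup is inherently non-finitely based (INFB) if it is not contained in any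
locally finite finitely based variety of unary semigroups. -/
def UnarySemigroupINFB (S : Type u) [Semigroup S] [Star S] [Finite S] : Prop :=
  ¬ ∃ V : UnarySemigroupClass.{u},
    IsUnarySemigroupVariety V ∧ UnarySemigroupLocallyFinite V ∧
      UnarySemigroupFinitelyBased V ∧ V S

/-- `var S`, the variety generated by the unary semigroup `S`: the unary semigroups that belong to
every variety of unary semigroups containing `S`. -/
def unaryVar (S : Type u) [Semigroup S] [Star S] : UnarySemigroupClass.{u} :=
  fun T _ _ => ∀ V : UnarySemigroupClass.{u}, IsUnarySemigroupVariety V → V S → V T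

/-! ### The 3-element twisted semilattice -/

/-- The underlying set `{e, f, 0}` of the 3-element twisted semilattice. -/
inductive TSL : Type u
  | e
  | f
  | zero

/-- `e * e = e`, `f * f = f`, and all other products are `0`. -/
def TSL.mul : TSL.{u} → TSL.{u} → TSL.{u}
  | .e, .e => .e
  | .f, .f => .f
  | _, _ => .zero

/-- `e` and `f` are interchanged, `0` is fixed. -/
def TSL.inv : TSL.{u} → TSL.{u}
  | .e => .f
  | .f => .e
  | .zero => .zero

instance : Semigroup TSL.{u} where
  mul := TSL.mul
  mul_assoc a b c := by cases a <;> cases b <;> cases c <;> rfl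

instance : StarMul TSL.{u} where
  star := TSL.inv
  star_involutive a := by cases a <;> rfl
  star_mul a b := by cases a <;> cases b <;> rfl

/-!
Suppose that `S` lies in a locally finite variety `V` of unary semigroups defined by a finite set
`E` of identities; a locally finite finitely based variety of semigroups containing the reduct of
`S` is extracted from it.

For a semigroup `A`, let `TwistedDouble A` be the disjoint union of `A`, its dual and a zero, where
mixed products vanish and the star exchanges `A` with its dual. Declare every letter to be either
positive or negative, send it to the corresponding copy of itself in the twisted double of the free
semigroup, and evaluate both sides of an identity in `E`. Whenever both sides land in the same
nonzero half, they give a plain identity; let `plainConsequences E` consist of all of these.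
It is finite, as each term takes only finitely many values over all choices of signs
(`finite_range_eval_generic`), and it holds in every involutory semigroup satisfying `E`
(`satisfiesPlain_plainConsequences`), in particular in `S`.

Conversely, if `A` satisfies `plainConsequences E`, then `TwistedDouble A` satisfies `E`
(`TwistedDouble.satisfiesUnary`). This is where the twisted semilattice enters: since it belongs to
`V`, it satisfies `E`, so the two sides of an identity in `E`, evaluated in `TwistedDouble A`, lie
in the same one of the three parts. If this part is nonzero, the two values agree by a plain
consequence. Thus if such an `A` is finitely generated, then so is `TwistedDouble A`, which is a
member of `V`; hence it is finite, and so is its subset `A`.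
-/

/-! ### Varieties defined by plain identities -/

theorem map_freeSemigroup_lift {A B : Type*} [Semigroup A] [Semigroup B] (f : A →ₙ* B)
    (φ : ℕ → A) (w : FreeSemigroup ℕ) :
    f (FreeSemigroup.lift φ w) = FreeSemigroup.lift (fun n => f (φ n)) w :=
  DFunLike.congr_fun
    (FreeSemigroup.hom_ext (f := f.comp (FreeSemigroup.lift φ)) (by ext; simp)) w

theorem isSemigroupVariety_of_identities (E : Set PlainIdentity) :
    IsSemigroupVariety.{u} fun A _ => ∀ p ∈ E, SatisfiesPlain A p where
  image A B _ _ f hf hA p hp φ := by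
    choose g hg using hf
    have h := congrArg f (hA p hp fun n => g (φ n))
    simpa only [map_freeSemigroup_lift, hg] using h
  sub A B _ _ f hf hB p hp φ := by
    apply hf
    simpa only [map_freeSemigroup_lift] using hB p hp fun n => f (φ n)
  prod ι A _ hA p hp φ := by
    funext i
    have h := hA i p hp fun n => φ n i
    have key : ∀ w, FreeSemigroup.lift φ w i = FreeSemigroup.lift (fun n => φ n i) w :=
      map_freeSemigroup_lift (Pi.evalMulHom A i) φ
    rw [key, key, h]

/-! ### The twisted double of a semigroup -/

/-- The disjoint union of a semigroup `A`, its dual and a zero: `pos a` is the element `a` itself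
and `neg a` stands for its formal star. Products of a positive and a negative element vanish. -/
inductive TwistedDouble (A : Type*) : Type _
  | pos : A → TwistedDouble A
  | neg : A → TwistedDouble A
  | zero : TwistedDouble A

namespace TwistedDouble

variable {A : Type*}

instance [Semigroup A] : Semigroup (TwistedDouble A) where
  mul
    | pos a, pos b => pos (a * b)
    | neg a, neg b => neg (b * a)
    | _, _ => zero
  mul_assoc x y z := by
    rcases x with a | a | _ <;> rcases y with b | b | _ <;> rcases z with c | c | _ <;>
      first
      | rfl
      | exact congrArg pos (mul_assoc a b c)
      | exact congrArg neg (mul_assoc c b a).symm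

instance : Star (TwistedDouble A) where
  star
    | pos a => neg a
    | neg a => pos a
    | zero => zero

theorem pos_injective : Function.Injective (pos : A → TwistedDouble A) := by
  rintro a b ⟨⟩
  rfl

theorem fg_of_fg [Semigroup A] (hA : SemigroupFG A) : UnarySemigroupFG (TwistedDouble A) := by
  obtain ⟨X, hX, hgen⟩ := hA
  refine ⟨insert zero (pos '' X), (hX.image _).insert _, fun T hXT hT => ?_⟩
  have hpos : ∀ a, pos a ∈ T := fun a => by
    have ha : a ∈ Subsemigroup.closure X := hgen ▸ Subsemigroup.mem_top a
    induction ha using Subsemigroup.closure_induction with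
    | mem x hx => exact hXT (Or.inr ⟨x, hx, rfl⟩)
    | mul x y _ _ hx hy => exact T.mul_mem hx hy
  refine eq_top_iff.2 fun x _ => ?_
  rcases x with a | a | _
  · exact hpos a
  · exact hT _ (hpos a)
  · exact hXT (Or.inl rfl)

/-- The homomorphism onto the twisted semilattice recording the part in which an element lies. -/
def part : TwistedDouble A → TSL.{u}
  | pos _ => .e
  | neg _ => .f
  | zero => .zero

theorem part_eval [Semigroup A] (φ : ℕ → TwistedDouble A) (t : UnaryTerm) :
    part.{u} (t.eval φ) = t.eval fun n => part (φ n) := by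
  induction t with
  | var n => rfl
  | mul s t hs ht =>
    simp only [UnaryTerm.eval, ← hs, ← ht]
    rcases s.eval φ with a | a | _ <;> rcases t.eval φ with b | b | _ <;> rfl
  | starred t ht =>
    simp only [UnaryTerm.eval, ← ht]
    rcases t.eval φ with a | a | _ <;> rfl

/-- Functoriality of the twisted double. -/
def map {B : Type*} (f : A → B) : TwistedDouble A → TwistedDouble B
  | pos a => pos (f a)
  | neg a => neg (f a)
  | zero => zero

theorem map_mul {B : Type*} [Semigroup A] [Semigroup B] (f : A →ₙ* B) (x y : TwistedDouble A) :
    map f (x * y) = map f x * map f y := by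
  rcases x with a | a | _ <;> rcases y with b | b | _ <;>
    first
    | rfl
    | exact congrArg pos (_root_.map_mul f a b)
    | exact congrArg neg (_root_.map_mul f b a)

theorem map_star {B : Type*} (f : A → B) (x : TwistedDouble A) :
    map f (star x) = star (map f x) := by
  cases x <;> rfl

end TwistedDouble

/-! ### Plain consequences of unary identities -/

open TwistedDouble

/-- The substitution sending each letter to itself or to its formal star, as the sign `c`
prescribes. -/
def genericSubst (c : ℕ → Bool) (n : ℕ) : TwistedDouble (FreeSemigroup ℕ) :=
  if c n then pos (.of n) else neg (.of n)

/-- The plain identities read off from the identities in `E` by choosing a sign for every letter,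
whenever both sides then become positive words or both become stars of positive words. -/
def plainConsequences (E : Set UnaryIdentity) : Set PlainIdentity :=
  {q | ∃ p ∈ E, ∃ c : ℕ → Bool,
    (p.1.eval (genericSubst c) = pos q.1 ∧ p.2.eval (genericSubst c) = pos q.2) ∨
    (p.1.eval (genericSubst c) = neg q.1 ∧ p.2.eval (genericSubst c) = neg q.2)}

theorem finite_range_eval_generic (t : UnaryTerm) :
    (Set.range fun c : ℕ → Bool => t.eval (genericSubst c)).Finite := by
  induction t with
  | var n =>
    refine (Set.toFinite {pos (.of n), neg (.of n)}).subset ?_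
    rintro _ ⟨c, rfl⟩
    cases h : c n <;> simp [UnaryTerm.eval, genericSubst, h]
  | mul s t hs ht =>
    refine (hs.image2 (· * ·) ht).subset ?_
    rintro _ ⟨c, rfl⟩
    exact ⟨_, ⟨c, rfl⟩, _, ⟨c, rfl⟩, rfl⟩
  | starred t ht =>
    refine (ht.image star).subset ?_
    rintro _ ⟨c, rfl⟩
    exact ⟨_, ⟨c, rfl⟩, rfl⟩

theorem finite_plainConsequences {E : Set UnaryIdentity} (hE : E.Finite) :
    (plainConsequences E).Finite := by
  have key : ∀ f : FreeSemigroup ℕ → TwistedDouble (FreeSemigroup ℕ), Function.Injective f →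
      (⋃ p ∈ E, Prod.map f f ⁻¹'
        ((Set.range fun c : ℕ → Bool => p.1.eval (genericSubst c)) ×ˢ
          Set.range fun c : ℕ → Bool => p.2.eval (genericSubst c))).Finite := fun f hf =>
    hE.biUnion fun p _ =>
      ((finite_range_eval_generic p.1).prod (finite_range_eval_generic p.2)).preimage
        (hf.prodMap hf).injOn
  have hneg : Function.Injective (neg : FreeSemigroup ℕ → _) := fun a b h => by cases h; rfl
  refine ((key pos pos_injective).union (key neg hneg)).subset ?_
  rintro q ⟨p, hp, c, ⟨h₁, h₂⟩ | ⟨h₁, h₂⟩⟩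
  · exact Or.inl (Set.mem_biUnion hp ⟨⟨c, h₁⟩, ⟨c, h₂⟩⟩)
  · exact Or.inr (Set.mem_biUnion hp ⟨⟨c, h₁⟩, ⟨c, h₂⟩⟩)

/-- If a term becomes `w`, or the formal star of `w`, under a choice of signs, then its value in an
involutory semigroup is that of `w`, or its star, once the negative letters are replaced by their
stars. -/
theorem eval_of_eval_genericSubst {S : Type*} [Semigroup S] [StarMul S] (c : ℕ → Bool) (σ : ℕ → S)
    (t : UnaryTerm) (w : FreeSemigroup ℕ) :
    (t.eval (genericSubst c) = pos w →
      t.eval (fun n => if c n then σ n else star (σ n)) = FreeSemigroup.lift σ w) ∧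
    (t.eval (genericSubst c) = neg w →
      t.eval (fun n => if c n then σ n else star (σ n)) = star (FreeSemigroup.lift σ w)) := by
  induction t generalizing w with
  | var n =>
    cases h : c n <;> simp only [UnaryTerm.eval, genericSubst, h] <;>
      constructor <;> rintro ⟨⟩ <;> simp
  | mul s t hs ht =>
    simp only [UnaryTerm.eval]
    generalize s.eval (genericSubst c) = x at hs
    generalize t.eval (genericSubst c) = y at ht
    rcases x with a | a | _ <;> rcases y with b | b | _ <;> constructor <;> rintro ⟨⟩
    · rw [(hs a).1 rfl, (ht b).1 rfl, _root_.map_mul (FreeSemigroup.lift σ)]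
    · rw [(hs a).2 rfl, (ht b).2 rfl, _root_.map_mul (FreeSemigroup.lift σ), star_mul]
  | starred t ht =>
    simp only [UnaryTerm.eval]
    generalize t.eval (genericSubst c) = x at ht
    rcases x with a | a | _ <;> constructor <;> rintro ⟨⟩
    · rw [(ht w).1 rfl]
    · rw [(ht w).2 rfl, star_star]

theorem satisfiesPlain_plainConsequences {S : Type u} [Semigroup S] [StarMul S]
    {E : Set UnaryIdentity} (hE : ∀ p ∈ E, SatisfiesUnary S p) :
    ∀ q ∈ plainConsequences E, SatisfiesPlain S q := by
  rintro q ⟨p, hp, c, ⟨h₁, h₂⟩ | ⟨h₁, h₂⟩⟩ σ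
  · rw [← (eval_of_eval_genericSubst c σ _ _).1 h₁, ← (eval_of_eval_genericSubst c σ _ _).1 h₂]
    exact hE p hp _
  · apply star_injective
    rw [← (eval_of_eval_genericSubst c σ _ _).2 h₁, ← (eval_of_eval_genericSubst c σ _ _).2 h₂]
    exact hE p hp _

/-- Nonzero values in a twisted double come from the twisted double of the free semigroup. Only the
letters with nonzero value matter, as any other letter would make the whole term vanish. -/
theorem TwistedDouble.map_eval_genericSubst {A : Type*} [Semigroup A] {φ : ℕ → TwistedDouble A}
    {c : ℕ → Bool} {σ : ℕ → A}
    (h : ∀ n, φ n ≠ zero → φ n = if c n then pos (σ n) else neg (σ n))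
    (t : UnaryTerm) (ht : t.eval φ ≠ zero) :
    TwistedDouble.map (FreeSemigroup.lift σ) (t.eval (genericSubst c)) = t.eval φ := by
  induction t with
  | var n =>
    simp only [UnaryTerm.eval] at ht ⊢
    rw [h n ht, genericSubst]
    split_ifs <;> simp [TwistedDouble.map]
  | mul s t ihs iht =>
    simp only [UnaryTerm.eval] at ht ⊢
    rw [TwistedDouble.map_mul, ihs, iht]
    · intro h0
      apply ht
      rw [h0]
      cases s.eval φ <;> rfl
    · intro h0
      apply ht
      rw [h0]
      rfl
  | starred t iht =>
    simp only [UnaryTerm.eval] at ht ⊢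
    rw [TwistedDouble.map_star, iht]
    intro h0
    apply ht
    rw [h0]
    rfl

theorem TwistedDouble.satisfiesUnary {A : Type u} [Semigroup A] [Nonempty A]
    {E : Set UnaryIdentity} (hTSL : ∀ p ∈ E, SatisfiesUnary TSL.{u} p)
    (hA : ∀ q ∈ plainConsequences E, SatisfiesPlain A q) :
    ∀ p ∈ E, SatisfiesUnary (TwistedDouble A) p := by
  intro p hp φ
  have hpart : part.{u} (p.1.eval φ) = part (p.2.eval φ) := by
    rw [part_eval, part_eval]
    exact hTSL p hp _
  have hlit : ∀ x : TwistedDouble A, ∃ (b : Bool) (a : A),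
      x ≠ zero → x = if b then pos a else neg a := by
    rintro (a | a | _)
    · exact ⟨true, a, fun _ => rfl⟩
    · exact ⟨false, a, fun _ => rfl⟩
    · exact ⟨true, Classical.arbitrary A, fun h => absurd rfl h⟩
  choose c σ h using fun n => hlit (φ n)
  have h₁ := map_eval_genericSubst h p.1
  have h₂ := map_eval_genericSubst h p.2
  have hcons : ∀ q : PlainIdentity,
      ((p.1.eval (genericSubst c) = pos q.1 ∧ p.2.eval (genericSubst c) = pos q.2) ∨
        (p.1.eval (genericSubst c) = neg q.1 ∧ p.2.eval (genericSubst c) = neg q.2)) →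
      FreeSemigroup.lift σ q.1 = FreeSemigroup.lift σ q.2 :=
    fun q hq => hA q ⟨p, hp, c, hq⟩ σ
  generalize p.1.eval φ = x at *
  generalize p.2.eval φ = y at *
  generalize p.1.eval (genericSubst c) = v at *
  generalize p.2.eval (genericSubst c) = w at *
  rcases x with a | a | _ <;> rcases y with b | b | _ <;> cases hpart
  · have h₁ := h₁ nofun
    have h₂ := h₂ nofun
    rcases v with v | v | _ <;> cases h₁
    rcases w with w | w | _ <;> cases h₂
    exact congrArg pos (hcons (v, w) (Or.inl ⟨rfl, rfl⟩))
  · have h₁ := h₁ nofun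
    have h₂ := h₂ nofun
    rcases v with v | v | _ <;> cases h₁
    rcases w with w | w | _ <;> cases h₂
    exact congrArg neg (hcons (v, w) (Or.inr ⟨rfl, rfl⟩))
  · rfl

/-! ### Transfer of the property INFB -/

theorem theorem3p1 (S : Type u) [Semigroup S] [StarMul S] [Finite S]
    (hTSL : unaryVar S TSL.{u}) (hS : SemigroupINFB S) :
    UnarySemigroupINFB S := by
  rintro ⟨V, hV, hfin, ⟨E, hE, hVE⟩, hVS⟩
  refine hS ⟨fun A _ => ∀ q ∈ plainConsequences E, SatisfiesPlain A q,
    isSemigroupVariety_of_identities _, fun A _ hA hfg => ?_,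
    ⟨_, finite_plainConsequences hE, fun A _ => Iff.rfl⟩,
    satisfiesPlain_plainConsequences ((hVE S).1 hVS)⟩
  rcases isEmpty_or_nonempty A with _ | _
  · infer_instance
  · have hD : V (TwistedDouble A) :=
      (hVE _).2 (TwistedDouble.satisfiesUnary ((hVE _).1 (hTSL V hV hVS)) hA)
    have := hfin _ hD (TwistedDouble.fg_of_fg hfg)
    exact Finite.of_injective pos pos_injective
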